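/- Let $n\ge 2$ and $a,b\ge 0$ be integers, and put $m=a+b+1$. Let $W_{a,b}$ be the complex vector space of all linear maps $\Phi:M_n(\mathbb C)\to M_n(\mathbb C)^{\otimes a}\otimes M_n(\mathbb C)^{\otimes b}$ that are $(a,b)$-unitarily equivariant, i.e. $$\Phi(UXU^*)=(\overline U^{\otimes a}\otimes U^{\otimes b})\,\Phi(X)\,(\overline U^{\otimes a}\otimes U^{\otimes b})^*\qquad\text{for all unitary } U\in M_n(\mathbb C)\text{ and all }X\in M_n(\mathbb C).$$ The Choi matrix of $\Phi$ is $C_\Phi=\sum_{i,j}e_{ij}\otimes\Phi(e_{ij})\in M_n(\mathbb C)^{\otimes m}$. For $\pi\in S_m$ let $\sigma_m(\pi)$ be the operator $v_1\otimes\cdots\otimes v_m\mapsto v_{\pi^{-1}(1)}\otimes\cdots\otimes v_{\pi^{-1}(m)}$ on $(\mathbb C^n)^{\otimes m}$, and let $\Phi_\pi$ be the linear map with Choi matrix $C_{\Phi_\pi}=(\theta_n^{\otimes (a+1)}\otimes i_n^{\otimes b})[\sigma_m(\pi)]$, where $\theta_n$ is the transpose map and $i_n$ the identity map on $M_n(\mathbb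 C)$. A *wire diagram* has $m$ inputs (on the left) and $m$ outputs (on the right), one of each in every row $1,\dots,m$, and pairs these $2m$ dots by $m$ wires, every dot being an end of exactly one wire. It represents the matrix on $(\mathbb C^n)^{\otimes m}$ whose entry at row index $(x_1,\dots,x_m)$ and column index $(y_1,\dots,y_m)$ is obtained by putting $x_i$ on the $i$-th input and $y_i$ on the $i$-th output: it is $1$ if the two ends of every wire carry the same index, and $0$ otherwise. Colour the first $a+1$ inputs and the last $b$ outputs black, and the remaining $b$ inputs and the first $a+1$ outputs white, so that each row has one black and one white dot. Then: 1. The maps $\Phi_\pi$, $\pi\in S_m$, span $W_{a,b}$ and are pairwise distinct. They are linearly independent, hence a basis of $W_{a,b}$, if and only if $n\ge a+b+1$. 2. For every $\pi\in S_m$ the Choi matrix $C_{\Phi_\pi}$ is represented by exactly one wire diagram. In it every wire joins a black dot to a white dot, namely the black dot of row $j$ to the white dot of row $\pi(j)$, for $j=1,\dots,m$. 3. The map sending $\pi$ to the diagram of $C_{\Phi_\pi}$ is a bijection from $S_m$ onto the set of all one-to-one wirings between the black dots and the white dots. -/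

import Mathlib

open scoped Matrix Kronecker

namespace WireCalculus

/-! ### Tensor powers

`(ℂⁿ)^{⊗ m}` has the basis `e_{x 0} ⊗ ⋯ ⊗ e_{x (m-1)}`, indexed by `x : Fin m → Fin n`. Thus a vector
of it is a function `(Fin m → Fin n) → ℂ`, and `M_n(ℂ)^{⊗ m}` is the algebra of square matrices
indexed by `Fin m → Fin n`. -/

/-- The algebra `M_n(ℂ)`. -/
abbrev Mat (n : ℕ) := Matrix (Fin n) (Fin n) ℂ

/-- The algebra `M_n(ℂ)^{⊗ m}`. -/
abbrev TMat (n m : ℕ) := Matrix (Fin m → Fin n) (Fin m → Fin n) ℂ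

/-- The elementary tensor `v 0 ⊗ ⋯ ⊗ v (m-1)`. -/
def pureVec {n m : ℕ} (v : Fin m → Fin n → ℂ) : (Fin m → Fin n) → ℂ :=
  fun x => ∏ i, v i (x i)

/-- The elementary tensor `A 0 ⊗ ⋯ ⊗ A (m-1)`. -/
def pureMat {n m : ℕ} (A : Fin m → Mat n) : TMat n m :=
  Matrix.of fun x y => ∏ i, A i (x i) (y i)

theorem pureMat_mulVec {n m : ℕ} (A : Fin m → Mat n) (v : Fin m → Fin n → ℂ) :
    pureMat A *ᵥ pureVec v = pureVec fun i => A i *ᵥ v i := by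
  funext x
  simp only [pureMat, pureVec, Matrix.mulVec, dotProduct, Matrix.of_apply,
    ← Finset.prod_mul_distrib]
  rw [Finset.prod_univ_sum]
  simp

/-! ### `(a,b)`-unitarily equivariant maps -/

/-- The operator `Ū^{⊗ a} ⊗ U^{⊗ b}`. -/
def mixedPower {n : ℕ} (a b : ℕ) (U : Mat n) : TMat n (a + b) :=
  pureMat (Fin.append (fun _ : Fin a => U.map star) (fun _ : Fin b => U))

/-- The vector space `W_{a,b}` of all `(a,b)`-unitarily equivariant linear maps
`M_n(ℂ) → M_n(ℂ)^{⊗ a} ⊗ M_n(ℂ)^{⊗ b}`. -/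
def equivariantMaps (n a b : ℕ) : Submodule ℂ (Mat n →ₗ[ℂ] TMat n (a + b)) where
  carrier := {Φ | ∀ U ∈ Matrix.unitaryGroup (Fin n) ℂ, ∀ X : Mat n,
    Φ (U * X * Uᴴ) = mixedPower a b U * Φ X * (mixedPower a b U)ᴴ}
  add_mem' := by
    intro Φ Ψ hΦ hΨ U hU X
    simp only [LinearMap.add_apply, hΦ U hU X, hΨ U hU X, Matrix.mul_add, Matrix.add_mul]
  zero_mem' := by
    intro U _ X
    simp
  smul_mem' := by
    intro c Φ hΦ U hU X
    simp only [LinearMap.smul_apply, hΦ U hU X, Matrix.mul_smul, Matrix.smul_mul]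

/-! ### Choi matrices -/

/-- The Choi matrix `C_Φ = (i_n ⊗ Φ)(∑ i j, e_ij ⊗ e_ij) = ∑ i j, e_ij ⊗ Φ(e_ij)`, as an element of
`M_n(ℂ) ⊗ M_n(ℂ)^{⊗ k} = M_n(ℂ)^{⊗ (k+1)}`. -/
def choi {n k : ℕ} (Φ : Mat n →ₗ[ℂ] TMat n k) : TMat n (k + 1) :=
  Matrix.reindex (Fin.consEquiv fun _ : Fin (k + 1) => Fin n)
    (Fin.consEquiv fun _ : Fin (k + 1) => Fin n)
    (∑ i : Fin n, ∑ j : Fin n, Matrix.single i j (1 : ℂ) ⊗ₖ Φ (Matrix.single i j 1))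

/-- The linear map with a given Choi matrix. -/
def ofChoi {n k : ℕ} (C : TMat n (k + 1)) : Mat n →ₗ[ℂ] TMat n k where
  toFun X := Matrix.of fun x y => ∑ i, ∑ j, X i j * C (Fin.cons i x) (Fin.cons j y)
  map_add' X Y := by
    ext x y
    simp [add_mul, Finset.sum_add_distrib]
  map_smul' c X := by
    ext x y
    simp [mul_assoc, Finset.mul_sum]

theorem choi_apply {n k : ℕ} (Φ : Mat n →ₗ[ℂ] TMat n k) (x y : Fin (k + 1) → Fin n) :
    choi Φ x y = Φ (Matrix.single (x 0) (y 0) 1) (Fin.tail x) (Fin.tail y) := by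
  simp [choi, Fin.consEquiv, Matrix.sum_apply, Matrix.kroneckerMap_apply, Matrix.single_apply,
    ite_and]

theorem choi_ofChoi {n k : ℕ} (C : TMat n (k + 1)) : choi (ofChoi C) = C := by
  ext x y
  simp [choi_apply, ofChoi, Matrix.single_apply, ite_and]

theorem ofChoi_choi {n k : ℕ} (Φ : Mat n →ₗ[ℂ] TMat n k) : ofChoi (choi Φ) = Φ := by
  refine LinearMap.ext fun X => ?_
  ext x y
  conv_rhs => rw [Matrix.matrix_eq_sum_single X]
  simp only [ofChoi, choi_apply, LinearMap.coe_mk, AddHom.coe_mk, Matrix.of_apply, Fin.cons_zero,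
    Fin.tail_cons, map_sum, Matrix.sum_apply]
  refine Finset.sum_congr rfl fun i _ => Finset.sum_congr rfl fun j _ => ?_
  have h : Matrix.single i j (X i j) = X i j • Matrix.single i j (1 : ℂ) := by simp
  rw [h, map_smul, Matrix.smul_apply, smul_eq_mul]

/-! ### The maps `Φ_π` -/

/-- The operator `σ_m(π)` on `(ℂⁿ)^{⊗ m}`; see `permOp_mulVec`. -/
def permOp (n : ℕ) {m : ℕ} (π : Equiv.Perm (Fin m)) : TMat n m :=
  Matrix.of fun x y => if ∀ i, x i = y (π⁻¹ i) then 1 else 0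

/-- `σ_m(π) (v_1 ⊗ ⋯ ⊗ v_m) = v_{π⁻¹(1)} ⊗ ⋯ ⊗ v_{π⁻¹(m)}`. -/
theorem permOp_mulVec {n m : ℕ} (π : Equiv.Perm (Fin m)) (v : Fin m → Fin n → ℂ) :
    permOp n π *ᵥ pureVec v = pureVec fun i => v (π⁻¹ i) := by
  funext x
  have h : ∀ y : Fin m → Fin n, (∀ i, x i = y (π⁻¹ i)) ↔ x ∘ π = y := by
    intro y
    constructor
    · intro h
      funext j
      simpa using h (π j)
    · rintro rfl i
      simp
  simp only [permOp, pureVec, Matrix.mulVec, dotProduct, Matrix.of_apply, h, ite_mul, one_mul,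
    zero_mul, Finset.sum_ite_eq, Finset.mem_univ, if_true]
  exact Fintype.prod_equiv π _ _ (by simp)

/-- The map `θ_n^{⊗ r} ⊗ i_n^{⊗ (m-r)}` on `M_n(ℂ)^{⊗ m}` which transposes the first `r` tensor
factors; see `partialTranspose_pureMat`. -/
def partialTranspose {n m : ℕ} (r : ℕ) : TMat n m →ₗ[ℂ] TMat n m where
  toFun C := Matrix.of fun x y =>
    C (fun i => if i.val < r then y i else x i) (fun i => if i.val < r then x i else y i)
  map_add' _ _ := rfl
  map_smul' _ _ := rfl

theorem partialTranspose_pureMat {n m : ℕ} (r : ℕ) (A : Fin m → Mat n) :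
    partialTranspose r (pureMat A) = pureMat fun i => if i.val < r then (A i)ᵀ else A i := by
  ext x y
  change ∏ i, A i _ _ = ∏ i, (if i.val < r then (A i)ᵀ else A i) (x i) (y i)
  refine Finset.prod_congr rfl fun i _ => ?_
  by_cases h : i.val < r <;> simp [h]

/-- The map `Φ_π` with the Choi matrix `(θ_n^{⊗ (a+1)} ⊗ i_n^{⊗ b})(σ_{a+b+1}(π))`. -/
def basisMap (n a b : ℕ) (π : Equiv.Perm (Fin (a + b + 1))) : Mat n →ₗ[ℂ] TMat n (a + b) :=
  ofChoi (partialTranspose (a + 1) (permOp n π))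

theorem choi_basisMap (n a b : ℕ) (π : Equiv.Perm (Fin (a + b + 1))) :
    choi (basisMap n a b π) = partialTranspose (a + 1) (permOp n π) :=
  choi_ofChoi _

/-! ### Wire diagrams -/

/-- The dots of a diagram with `m` rows: an input on the left and an output on the right of each
row. -/
inductive Dot (m : ℕ) where
  | input (i : Fin m) : Dot m
  | output (i : Fin m) : Dot m

/-- The row of a dot. -/
def Dot.row {m : ℕ} : Dot m → Fin m
  | .input i => i
  | .output i => i

/-- A wire diagram on `m` inputs and `m` outputs: every dot is the end of exactly one wire, which
leads to another dot. -/
@[ext] structure WireDiagram (m : ℕ) where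
  /-- The other end of the wire at a given dot. -/
  partner : Dot m → Dot m
  partner_partner : ∀ p, partner (partner p) = p
  partner_ne : ∀ p, partner p ≠ p

/-- The basis index which the matrix entry at row index `x` and column index `y` puts on a dot. In
the graphical calculus, the legs on the left carry the row index and the legs on the right carry
the column index, so that a product `AB` is drawn as `A` followed by `B` from left to right. -/
def Dot.label {n m : ℕ} (x y : Fin m → Fin n) : Dot m → Fin n
  | .input i => x i
  | .output i => y i

/-- The matrix on `(ℂⁿ)^{⊗ m}` that a wire diagram represents in the graphical calculus: a wire is
a Kronecker delta between the indices at its two ends, and the entry is the product of the deltas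
of all wires. -/
noncomputable def WireDiagram.toMatrix (n : ℕ) {m : ℕ} (D : WireDiagram m) : TMat n m :=
  open Classical in
  Matrix.of fun x y => if ∀ p, Dot.label x y p = Dot.label x y (D.partner p) then 1 else 0

/-- The black dots: the first `a + 1` inputs and the last `b` outputs. -/
def Dot.IsBlack (a b : ℕ) : Dot (a + b + 1) → Prop
  | .input i => i.val < a + 1
  | .output i => a + 1 ≤ i.val

/-- The black dots. -/
abbrev BlackDot (a b : ℕ) := {p : Dot (a + b + 1) // p.IsBlack a b}

/-- The white dots: the last `b` inputs and the first `a + 1` outputs. -/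
abbrev WhiteDot (a b : ℕ) := {p : Dot (a + b + 1) // ¬ p.IsBlack a b}

/-- A one-to-one wiring between the black dots and the white dots. -/
abbrev Wiring (a b : ℕ) := BlackDot a b ≃ WhiteDot a b

open Classical in
/-- The wire diagram that consists of the wires of a black-white wiring. -/
noncomputable def Wiring.toDiagram {a b : ℕ} (w : Wiring a b) : WireDiagram (a + b + 1) where
  partner p := if h : p.IsBlack a b then (w ⟨p, h⟩).val else (w.symm ⟨p, h⟩).val
  partner_partner p := by
    by_cases h : p.IsBlack a b
    · have h' := (w ⟨p, h⟩).property
      simp [h, h']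
    · have h' := (w.symm ⟨p, h⟩).property
      simp [h, h']
  partner_ne p := by
    by_cases h : p.IsBlack a b
    · have h' := (w ⟨p, h⟩).property
      simp only [h, dite_true]
      intro e
      rw [e] at h'
      exact h' h
    · have h' := (w.symm ⟨p, h⟩).property
      simp only [h, dite_false]
      intro e
      rw [e] at h'
      exact h h'

end WireCalculus

open WireCalculus

/-! The Choi correspondence combined with transposition of the first `a + 1` factors carries
conjugation by `U^{⊗ m}` to the action defining equivariance, and `σ_m(π)` to `Φ_π`. So `W_{a,b}`
corresponds to the commutant of all unitary `U^{⊗ m}`, and spanning is Schur–Weyl duality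
(`ofWiredChoi_mem_equivariantMaps_iff`, `mem_span_permOp_of_commute`).

For the duality, the Cayley transform and polynomial identities extend commutation from unitary `U`
to all matrices `G`. Pairing with symmetric functions then gives commutation with everything in the
commutant of `S_m`, and the double commutant theorem finishes.

For `m ≤ n` a basis tensor with distinct indices separates the permutations; for `n < m` the
antisymmetrizer is a linear relation. Finally, after the partial transposition the row and column
indices of `σ_m(π)` are the labels of the white and black dots. This yields the diagram, and two
labels suffice to recover a diagram from its matrix. -/

/-! ### Symmetric functions and the double commutant. -/

/-- If the fibers of two maps have the same cardinality, the maps differ by a permutation. -/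
theorem exists_perm_comp_eq {ι α : Type*} [Fintype ι] [DecidableEq α] (z w : ι → α)
    (h : ∀ a, Fintype.card {i // z i = a} = Fintype.card {i // w i = a}) :
    ∃ e : Equiv.Perm ι, w ∘ e = z := by
  have E := fun a => Classical.choice (Fintype.card_eq.1 (h a))
  refine ⟨(Equiv.sigmaFiberEquiv z).symm.trans
    ((Equiv.sigmaCongrRight fun a => (E a)).trans (Equiv.sigmaFiberEquiv w)), ?_⟩
  funext i
  exact (E (z i) ⟨i, rfl⟩).2

/-- If a form `∑ f z ∏ G (z i)` vanishes for all `G`, then `f` is orthogonal to all symmetric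
functions. -/
theorem sum_mul_symmetric_eq_zero {m : ℕ} {α : Type*} [Fintype α] [DecidableEq α]
    (f B : (Fin m → α) → ℂ) (hB : ∀ z (e : Equiv.Perm (Fin m)), B (z ∘ e) = B z)
    (hf : ∀ G : α → ℂ, ∑ z, f z * ∏ i, G (z i) = 0) : ∑ z, f z * B z = 0 := by
  -- The exponent vector of `∏ X (z i)`: it counts the values of `z`, hence determines `z` up to a
  -- permutation of its arguments.
  let d : (Fin m → α) → (α →₀ ℕ) := fun z => ∑ i, Finsupp.single (z i) 1
  have hd : ∀ z a, d z a = Fintype.card {i // z i = a} := by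
    intro z a
    simp [d, Finsupp.finsetSum_apply, Finsupp.single_apply, Fintype.card_subtype]
  let p : MvPolynomial α ℂ := ∑ z, MvPolynomial.monomial (d z) (f z)
  have hp : p = 0 := by
    refine MvPolynomial.funext fun G => ?_
    have hm : ∀ z, MvPolynomial.monomial (d z) (f z)
        = MvPolynomial.C (f z) * ∏ i, MvPolynomial.X (z i) := by
      intro z
      rw [MvPolynomial.monomial_eq]
      congr 1
      rw [Finsupp.prod_fintype _ _ (by simp)]
      simp only [hd]
      rw [← Finset.prod_fiberwise (s := Finset.univ) (g := z)]
      refine Finset.prod_congr rfl fun a _ => ?_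
      rw [Finset.prod_congr rfl (g := fun _ => MvPolynomial.X a)
        (fun i hi => by rw [(Finset.mem_filter.1 hi).2])]
      simp [Fintype.card_subtype]
    simp only [p, hm, map_sum, map_mul, MvPolynomial.eval_C, map_prod, MvPolynomial.eval_X, map_zero]
    exact hf G
  have hBd : ∀ z w, d z = d w → B z = B w := by
    intro z w h
    obtain ⟨e, rfl⟩ := exists_perm_comp_eq z w fun a => by rw [← hd, ← hd, h]
    exact hB w e
  -- `B` is constant on the fibers of `d`, while the sum of `f` over a fiber is a coefficient of `p
  -- = 0`.
  rw [← Finset.sum_fiberwise_of_maps_to (s := Finset.univ) (t := Finset.univ.image d) (g := d)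
    (fun z _ => Finset.mem_image_of_mem d (Finset.mem_univ z))]
  refine Finset.sum_eq_zero fun c hc => ?_
  obtain ⟨w, -, rfl⟩ := Finset.mem_image.1 hc
  rw [Finset.sum_congr rfl (g := fun z => f z * B w)
    (fun z hz => by rw [hBd z w (Finset.mem_filter.1 hz).2]), ← Finset.sum_mul]
  have := congrArg (MvPolynomial.coeff (d w)) hp
  simp only [p, MvPolynomial.coeff_sum, MvPolynomial.coeff_monomial, MvPolynomial.coeff_zero,
    ← Finset.sum_filter] at this
  rw [this, zero_mul]

/-- The double commutant theorem for a representation of a finite group. -/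
theorem mem_span_range_of_commute {G V : Type*} [Group G] [Fintype G] [AddCommGroup V]
    [Module ℂ V] [FiniteDimensional ℂ V] (ρ : Representation ℂ G V) (f : V →ₗ[ℂ] V)
    (h : ∀ T : V →ₗ[ℂ] V, (∀ g, T ∘ₗ ρ g = ρ g ∘ₗ T) → f ∘ₗ T = T ∘ₗ f) :
    f ∈ Submodule.span ℂ (Set.range ρ) := by
  classical
  let R := MonoidAlgebra ℂ G
  let M := ρ.asModule
  have hT : ∀ (T : Module.End R M) (v : V), f (T v) = T (f v) := by
    intro T v
    let T' : V →ₗ[ℂ] V := ρ.asModuleEquiv.toLinearMap ∘ₗ (T.restrictScalars ℂ) ∘ₗ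
      ρ.asModuleEquiv.symm.toLinearMap
    have := h T' (fun g => by
      ext v
      have h1 := T.map_smul (MonoidAlgebra.of ℂ G g) (ρ.asModuleEquiv.symm v)
      rw [← ρ.asModuleEquiv_symm_map_rho] at h1
      have h2 := congrArg ρ.asModuleEquiv h1
      rw [ρ.asModuleEquiv_map_smul, Representation.asAlgebraHom_of] at h2
      exact h2)
    exact LinearMap.congr_fun this v
  -- By `hT`, `f` is linear over the commutant of the group algebra, as the density theorem
  -- requires. Maschke's theorem supplies semisimplicity of `M`.
  let F : Module.End (Module.End R M) M :=
    { toFun := fun v => ρ.asModuleEquiv.symm (f (ρ.asModuleEquiv v))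
      map_add' := fun v w => by simp
      map_smul' := fun T v => hT T v }
  let b := Module.finBasis ℂ V
  obtain ⟨r, hr⟩ := jacobson_density F (Finset.univ.image fun i => ρ.asModuleEquiv.symm (b i))
  have hf : f = ρ.asAlgebraHom r := by
    refine b.ext fun i => ?_
    have := congrArg ρ.asModuleEquiv (hr _ (Finset.mem_image_of_mem _ (Finset.mem_univ i)))
    rw [ρ.asModuleEquiv_map_smul] at this
    exact this
  rw [hf, Representation.asAlgebraHom_def, MonoidAlgebra.lift_apply]
  exact Submodule.sum_mem _ fun g _ =>
    Submodule.smul_mem _ _ (Submodule.subset_span ⟨g, rfl⟩)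

namespace WireCalculus

/-! ### Elementary tensors, partial transposition and permutation operators. -/

variable {n m : ℕ}

theorem pureMat_mul (A B : Fin m → Mat n) :
    pureMat A * pureMat B = pureMat fun i => A i * B i := by
  ext x y
  simp only [pureMat, Matrix.mul_apply, Matrix.of_apply, ← Finset.prod_mul_distrib]
  rw [Finset.prod_univ_sum]
  simp

theorem pureMat_one : pureMat (fun _ : Fin m => (1 : Mat n)) = 1 := by
  ext x y
  simp only [pureMat, Matrix.of_apply, Matrix.one_apply, Finset.prod_ite_zero,
    Finset.prod_const_one, funext_iff, Finset.mem_univ, true_implies]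

theorem pureMat_conjTranspose (A : Fin m → Mat n) : (pureMat A)ᴴ = pureMat fun i => (A i)ᴴ := by
  ext x y
  simp [pureMat, Matrix.conjTranspose_apply]

theorem pureMat_single (x y : Fin m → Fin n) :
    pureMat (fun i => Matrix.single (x i) (y i) (1 : ℂ)) = Matrix.single x y 1 := by
  ext u v
  simp only [pureMat, Matrix.of_apply, Matrix.single_apply, Finset.prod_ite_zero,
    Finset.prod_const_one, funext_iff, Finset.mem_univ, true_implies, forall_and]

/-- Linear maps on a tensor power of `M_n(ℂ)` that agree on elementary tensors are equal. -/
theorem linearMap_ext_pureMat {V : Type*} [AddCommGroup V] [Module ℂ V] {f g : TMat n m →ₗ[ℂ] V}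
    (h : ∀ A, f (pureMat A) = g (pureMat A)) : f = g := by
  refine LinearMap.ext fun C => ?_
  induction C using Matrix.induction_on' with
  | h_zero => simp
  | h_add p q hp hq => simp [hp, hq]
  | h_std_basis x y c =>
    have : Matrix.single x y c = c • pureMat (fun i => Matrix.single (x i) (y i) (1 : ℂ)) := by
      rw [pureMat_single, Matrix.smul_single, smul_eq_mul, mul_one]
    rw [this, map_smul, map_smul, h]

theorem partialTranspose_partialTranspose (r : ℕ) (C : TMat n m) :
    partialTranspose r (partialTranspose r C) = C := by
  ext x y
  change C _ _ = C x y
  congr 1 <;> funext i <;> by_cases h : i.val < r <;> simp [h]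

/-- Transposition reverses products, so left and right multipliers trade places in the first `r`
factors. Linearity reduces the claim to elementary tensors. -/
theorem partialTranspose_mul_mul (r : ℕ) (A B : Fin m → Mat n) (C : TMat n m) :
    partialTranspose r (pureMat A * C * pureMat B) =
      pureMat (fun i => if i.val < r then (B i)ᵀ else A i) * partialTranspose r C *
        pureMat (fun i => if i.val < r then (A i)ᵀ else B i) := by
  have := linearMap_ext_pureMat
    (f := partialTranspose r ∘ₗ LinearMap.mulRight ℂ (pureMat B) ∘ₗ LinearMap.mulLeft ℂ (pureMat A))
    (g := LinearMap.mulRight ℂ (pureMat fun i => if i.val < r then (A i)ᵀ else B i) ∘ₗ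
      LinearMap.mulLeft ℂ (pureMat fun i => if i.val < r then (B i)ᵀ else A i) ∘ₗ
        partialTranspose r)
    (fun D => by
      simp only [LinearMap.comp_apply, LinearMap.mulLeft_apply, LinearMap.mulRight_apply,
        pureMat_mul, partialTranspose_pureMat]
      congr 1
      funext i
      by_cases h : i.val < r <;> simp [h, Matrix.mul_assoc])
  exact LinearMap.congr_fun this C

theorem permOp_apply (π : Equiv.Perm (Fin m)) (x y : Fin m → Fin n) :
    permOp n π x y = if x ∘ π = y then 1 else 0 := by
  have h : (∀ i, x i = y (π⁻¹ i)) ↔ x ∘ π = y := by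
    constructor
    · intro h
      funext j
      simpa using h (π j)
    · rintro rfl i
      simp
  simp only [permOp, Matrix.of_apply, h]

theorem permOp_mul_apply (π : Equiv.Perm (Fin m)) (C : TMat n m) (x y : Fin m → Fin n) :
    (permOp n π * C) x y = C (x ∘ π) y := by
  simp [Matrix.mul_apply, permOp_apply]

theorem mul_permOp_apply (π : Equiv.Perm (Fin m)) (C : TMat n m) (x y : Fin m → Fin n) :
    (C * permOp n π) x y = C x (y ∘ ⇑π⁻¹) := by
  have h : ∀ z : Fin m → Fin n, z ∘ π = y ↔ z = y ∘ ⇑π⁻¹ := by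
    intro z
    constructor
    · rintro rfl
      funext i
      simp
    · rintro rfl
      funext i
      simp
  simp [Matrix.mul_apply, permOp_apply, h]

/-- The permutation operators as a representation of the symmetric group. -/
noncomputable def permRep (n m : ℕ) :
    Representation ℂ (Equiv.Perm (Fin m)) ((Fin m → Fin n) → ℂ) where
  toFun π := Matrix.toLin' (permOp n π)
  map_one' := by
    refine (congrArg Matrix.toLin' ?_).trans Matrix.toLin'_one
    ext x y
    simp [permOp_apply, Matrix.one_apply]
  map_mul' π ρ := by
    change _ = Matrix.toLin' (permOp n π) ∘ₗ Matrix.toLin' (permOp n ρ)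
    rw [← Matrix.toLin'_mul]
    congr 1
    ext x y
    rw [permOp_mul_apply, permOp_apply, permOp_apply]
    rfl

/-! ### Schur–Weyl duality for all matrices. -/

theorem permOp_mul_pureMat_const (π : Equiv.Perm (Fin m)) (G : Mat n) :
    permOp n π * pureMat (fun _ => G) = pureMat (fun _ => G) * permOp n π := by
  ext x y
  rw [permOp_mul_apply, mul_permOp_apply]
  exact Fintype.prod_equiv π _ _ (by simp)

/-- An operator that commutes with all `G^{⊗ m}` commutes with all operators that commute with
the permutation operators. -/
theorem commute_of_commute_pureMat_const {A B : TMat n m}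
    (hA : ∀ G : Mat n, A * pureMat (fun _ => G) = pureMat (fun _ => G) * A)
    (hB : ∀ π, B * permOp n π = permOp n π * B) : A * B = B * A := by
  let pair := Equiv.arrowProdEquivProdArrow (Fin m) (fun _ => Fin n) (fun _ => Fin n)
  have hBsymm : ∀ x y (e : Equiv.Perm (Fin m)), B (x ∘ e) (y ∘ e) = B x y := by
    intro x y e
    have := congrFun (congrFun (hB e) x) (y ∘ e)
    rw [permOp_mul_apply, mul_permOp_apply] at this
    rw [← this]
    congr 1
    funext i
    simp
  ext x y
  -- An entry of the commutator with `A`. It vanishes on every `G^{⊗ m}`, and the entries of `B`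
  -- form a symmetric function of the index pairs.
  let f : TMat n m →ₗ[ℂ] ℂ := Matrix.entryLinearMap ℂ ℂ x y ∘ₗ
    (LinearMap.mulLeft ℂ A - LinearMap.mulRight ℂ A)
  have hf : ∀ C, f C = ∑ z : Fin m → Fin n × Fin n,
      f (Matrix.single (pair z).1 (pair z).2 1) * C (pair z).1 (pair z).2 := by
    intro C
    conv_lhs => rw [Matrix.matrix_eq_sum_single C]
    simp only [map_sum]
    rw [← Fintype.sum_prod_type', ← pair.sum_comp]
    refine Finset.sum_congr rfl fun z _ => ?_
    rw [mul_comm, ← smul_eq_mul, ← map_smul, Matrix.smul_single, smul_eq_mul, mul_one]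
  have h0 : f B = 0 := by
    rw [hf]
    refine sum_mul_symmetric_eq_zero _ (fun z => B (pair z).1 (pair z).2) ?_ ?_
    · intro z e
      exact hBsymm (pair z).1 (pair z).2 e
    · intro G
      have h1 : f (pureMat fun _ => Matrix.of fun i j => G (i, j)) = 0 := by
        simp [f, hA]
      rw [hf] at h1
      exact h1
  exact sub_eq_zero.1 h0

/-- Schur–Weyl duality for the general linear monoid. -/
theorem mem_span_permOp_of_commute {A : TMat n m}
    (hA : ∀ G : Mat n, A * pureMat (fun _ => G) = pureMat (fun _ => G) * A) :
    A ∈ Submodule.span ℂ (Set.range (permOp n (m := m))) := by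
  have h := mem_span_range_of_commute (permRep n m) (Matrix.toLin' A) (fun T hT => by
    obtain ⟨B, rfl⟩ := Matrix.toLin'.surjective T
    rw [← Matrix.toLin'_mul, ← Matrix.toLin'_mul, commute_of_commute_pureMat_const hA]
    intro π
    have := hT π
    change Matrix.toLin' B ∘ₗ Matrix.toLin' (permOp n π) =
      Matrix.toLin' (permOp n π) ∘ₗ Matrix.toLin' B at this
    rwa [← Matrix.toLin'_mul, ← Matrix.toLin'_mul, Matrix.toLin'.injective.eq_iff] at this)
  have h2 : Set.range (permRep n m) =
      (Matrix.toLin' : TMat n m ≃ₗ[ℂ] _) '' Set.range (permOp n (m := m)) := by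
    rw [← Set.range_comp]
    rfl
  rw [h2] at h
  change _ ∈ Submodule.span ℂ ((Matrix.toLin' : TMat n m ≃ₗ[ℂ] _).toLinearMap '' _) at h
  rw [Submodule.span_image] at h
  obtain ⟨B, hB, hBA⟩ := h
  exact Matrix.toLin'.injective hBA ▸ hB

/-! ### Zariski density of the unitary group. -/

theorem pureMat_const_smul (c : ℂ) (G : Mat n) :
    pureMat (fun _ : Fin m => c • G) = c ^ m • pureMat (fun _ => G) := by
  ext x y
  simp [pureMat, Finset.prod_mul_distrib]

theorem commute_pureMat_const_of_smul {A : TMat n m} {c : ℂ} (hc : c ≠ 0) {G : Mat n}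
    (h : A * pureMat (fun _ => c • G) = pureMat (fun _ => c • G) * A) :
    A * pureMat (fun _ => G) = pureMat (fun _ => G) * A := by
  rw [pureMat_const_smul, Matrix.mul_smul, Matrix.smul_mul] at h
  exact smul_right_injective _ (pow_ne_zero m hc) h

/-- The homogeneous Cayley transform `det(1 - iZ) (1 + iZ)(1 - iZ)⁻¹`. -/
noncomputable def cayley (Z : Mat n) : Mat n :=
  (1 + Complex.I • Z) * (1 - Complex.I • Z).adjugate

open scoped ComplexOrder in
theorem commute_cayley_of_isHermitian {A : TMat n m}
    (hA : ∀ U ∈ Matrix.unitaryGroup (Fin n) ℂ,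
      A * pureMat (fun _ => U) = pureMat (fun _ => U) * A)
    {H : Mat n} (hH : H.IsHermitian) :
    A * pureMat (fun _ => cayley H) = pureMat (fun _ => cayley H) * A := by
  set N : Mat n := 1 - Complex.I • H with hN
  set P : Mat n := 1 + Complex.I • H with hP
  have hNP : Nᴴ = P := by
    rw [hN, hP, Matrix.conjTranspose_sub, Matrix.conjTranspose_smul, hH.eq]
    simp
  have hPN : Pᴴ = N := by rw [← hNP, Matrix.conjTranspose_conjTranspose]
  have hcomm : N * P = P * N := by
    rw [hN, hP]
    generalize Complex.I • H = K
    noncomm_ring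
  -- `N * P = 1 + H²` is positive definite.
  have hdet : N.det ≠ 0 := by
    have h1 : N * P = 1 + Hᴴ * H := by
      have hI : (Complex.I • H) * (Complex.I • H) = -(H * H) := by
        rw [Matrix.smul_mul, Matrix.mul_smul, smul_smul, Complex.I_mul_I, neg_one_smul]
      have hsq : ∀ K : Mat n, (1 - K) * (1 + K) = 1 - K * K := fun K => by noncomm_ring
      rw [hH.eq, hN, hP, hsq, hI, sub_neg_eq_add]
    have h2 : (1 + Hᴴ * H).PosDef :=
      Matrix.PosDef.one.add_posSemidef (Matrix.posSemidef_conjTranspose_mul_self H)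
    have h3 := h2.det_pos.ne'
    rw [← h1, Matrix.det_mul] at h3
    exact left_ne_zero_of_mul h3
  have hnorm : ((‖N.det‖ : ℝ) : ℂ) ≠ 0 := by simpa using hdet
  -- Dividing `cayley H` by `|det N|` makes it unitary.
  refine commute_pureMat_const_of_smul (c := ((‖N.det‖ : ℝ) : ℂ)⁻¹) (inv_ne_zero hnorm) (hA _ ?_)
  rw [Matrix.mem_unitaryGroup_iff']
  have hW : (cayley H)ᴴ * cayley H = ((‖N.det‖ : ℝ) : ℂ) ^ 2 • (1 : Mat n) := by
    change (P * N.adjugate)ᴴ * (P * N.adjugate) = _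
    rw [Matrix.conjTranspose_mul, hPN, Matrix.adjugate_conjTranspose, hNP]
    calc P.adjugate * N * (P * N.adjugate) = P.adjugate * (N * P) * N.adjugate := by
          noncomm_ring
      _ = (P.adjugate * P) * (N * N.adjugate) := by rw [hcomm]; noncomm_ring
      _ = _ := by
          rw [Matrix.adjugate_mul, Matrix.mul_adjugate, ← hNP, Matrix.det_conjTranspose,
            Matrix.smul_mul, Matrix.one_mul, smul_smul, ← Complex.conj_mul']
          rfl
  rw [Matrix.star_eq_conjTranspose, Matrix.conjTranspose_smul, Matrix.smul_mul, Matrix.mul_smul,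
    hW, smul_smul, smul_smul]
  have : star ((‖N.det‖ : ℝ) : ℂ)⁻¹ = ((‖N.det‖ : ℝ) : ℂ)⁻¹ := by simp
  rw [this]
  convert one_smul ℂ (1 : Mat n)
  field_simp

/-- If `A` commutes with the tensor powers of a polynomial matrix at infinitely many arguments, it
does so at every argument. -/
theorem commute_pureMat_eval {A : TMat n m} (M : Matrix (Fin n) (Fin n) (Polynomial ℂ))
    {s : Set ℂ} (hs : s.Infinite)
    (h : ∀ t ∈ s, A * pureMat (fun _ => M.map (Polynomial.eval t)) =
      pureMat (fun _ => M.map (Polynomial.eval t)) * A) (t : ℂ) :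
    A * pureMat (fun _ => M.map (Polynomial.eval t)) =
      pureMat (fun _ => M.map (Polynomial.eval t)) * A := by
  ext x y
  let q : Polynomial ℂ := ∑ u, Polynomial.C (A x u) * ∏ i, M (u i) (y i) -
    ∑ u, (∏ i, M (x i) (u i)) * Polynomial.C (A u y)
  have hq : ∀ t, q.eval t =
      (A * pureMat (fun _ => M.map (Polynomial.eval t)) : TMat n m) x y -
        (pureMat (fun _ => M.map (Polynomial.eval t)) * A : TMat n m) x y := by
    intro t
    simp [q, Matrix.mul_apply, pureMat, Polynomial.eval_finsetSum,
      Polynomial.eval_prod]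
  have h0 : q = 0 := Polynomial.eq_zero_of_infinite_isRoot q (hs.mono fun t ht => by
    change q.eval t = 0
    rw [hq, h t ht, sub_self])
  have := hq t
  rw [h0, Polynomial.eval_zero] at this
  exact sub_eq_zero.1 this.symm

/-- Write `Z = X + iY` with `X`, `Y` Hermitian. `cayley (X + tY)` is polynomial in `t`, and for real
`t` its argument is Hermitian; the commutation relation therefore persists at `t = i`. -/
theorem commute_cayley {A : TMat n m}
    (hA : ∀ U ∈ Matrix.unitaryGroup (Fin n) ℂ,
      A * pureMat (fun _ => U) = pureMat (fun _ => U) * A) (Z : Mat n) :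
    A * pureMat (fun _ => cayley Z) = pureMat (fun _ => cayley Z) * A := by
  let X : Mat n := (realPart Z : Mat n)
  let Y : Mat n := (imaginaryPart Z : Mat n)
  have hX : X.IsHermitian := (realPart Z).2
  have hY : Y.IsHermitian := (imaginaryPart Z).2
  have hZ : Z = X + Complex.I • Y := (realPart_add_I_smul_imaginaryPart Z).symm
  let L : Matrix (Fin n) (Fin n) (Polynomial ℂ) :=
    Matrix.of fun i j => Polynomial.C Complex.I *
      (Polynomial.C (X i j) + Polynomial.X * Polynomial.C (Y i j))
  let M := (1 + L) * (1 - L).adjugate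
  have hM : ∀ t, M.map (Polynomial.eval t) = cayley (X + t • Y) := by
    intro t
    have hL : (Polynomial.evalRingHom t).mapMatrix L = Complex.I • (X + t • Y) := by
      ext i j
      simp [L, mul_comm t]
    change (Polynomial.evalRingHom t).mapMatrix M = _
    rw [map_mul, RingHom.map_adjugate, map_add, map_sub, map_one, hL]
    rfl
  have := commute_pureMat_eval (A := A) M
    (Set.infinite_range_of_injective Complex.ofReal_injective) (by
      rintro _ ⟨t, rfl⟩
      rw [hM]
      refine commute_cayley_of_isHermitian hA (hX.add ?_)
      rw [Matrix.IsHermitian, Matrix.conjTranspose_smul, hY.eq]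
      simp) Complex.I
  rwa [hM, ← hZ] at this

/-- The unitary group is Zariski dense: an operator that commutes with `U^{⊗ m}` for all unitary
`U` commutes with `G^{⊗ m}` for all matrices `G`. -/
theorem commute_pureMat_const_of_unitary {A : TMat n m}
    (hA : ∀ U ∈ Matrix.unitaryGroup (Fin n) ℂ,
      A * pureMat (fun _ => U) = pureMat (fun _ => U) * A) (G : Mat n) :
    A * pureMat (fun _ => G) = pureMat (fun _ => G) * A := by
  -- The value at `s` is `s * det (s + G)`, so this secures both `s ≠ 0` and the invertibility of `s
  -- + G`.
  obtain ⟨s, hs⟩ : ∃ s : ℂ, (Polynomial.X * (-G).charpoly).eval s ≠ 0 := by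
    by_contra! h
    exact mul_ne_zero Polynomial.X_ne_zero (-G).charpoly_monic.ne_zero
      (Polynomial.funext fun s => by rw [h, Polynomial.eval_zero])
  rw [Polynomial.eval_mul, Polynomial.eval_X, Matrix.eval_charpoly, sub_neg_eq_add] at hs
  have hs0 : s ≠ 0 := left_ne_zero_of_mul hs
  set K : Mat n := Matrix.scalar (Fin n) s + G with hK
  have hKdet : IsUnit K.det := (right_ne_zero_of_mul hs).isUnit
  -- The inverse Cayley transform of `G / s`; hence `cayley Z` is a nonzero multiple of `G`.
  let Z : Mat n := -Complex.I • ((G - Matrix.scalar (Fin n) s) * K⁻¹)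
  have hZ : Complex.I • Z = (G - Matrix.scalar (Fin n) s) * K⁻¹ := by
    simp [Z, smul_smul]
  have hscalar : Matrix.scalar (Fin n) s = s • (1 : Mat n) := by
    rw [Matrix.scalar_apply, Matrix.smul_one_eq_diagonal]
  set N : Mat n := 1 - Complex.I • Z with hN
  have hNK : N * K = (2 * s) • (1 : Mat n) := by
    rw [hN, hZ, Matrix.sub_mul, Matrix.mul_assoc, Matrix.nonsing_inv_mul _ hKdet, hK, hscalar,
      mul_smul, two_smul]
    simp only [Matrix.one_mul, Matrix.mul_one]
    abel
  have hPK : (1 + Complex.I • Z) * K = (2 : ℂ) • G := by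
    rw [hZ, Matrix.add_mul, Matrix.mul_assoc, Matrix.nonsing_inv_mul _ hKdet, hK, hscalar,
      two_smul]
    simp only [Matrix.one_mul, Matrix.mul_one]
    abel
  have hNdet : N.det ≠ 0 := by
    have h := congrArg Matrix.det hNK
    rw [Matrix.det_mul, Matrix.det_smul, Matrix.det_one, mul_one] at h
    refine left_ne_zero_of_mul (b := K.det) ?_
    rw [h]
    exact pow_ne_zero _ (mul_ne_zero two_ne_zero hs0)
  have hadj : (2 * s) • N.adjugate = N.det • K := by
    have h : N.adjugate * (N * K) = N.det • K := by
      rw [← Matrix.mul_assoc, Matrix.adjugate_mul, Matrix.smul_mul, Matrix.one_mul]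
    rw [← h, hNK, Matrix.mul_smul, Matrix.mul_one]
  have hW : cayley Z = (N.det / s) • G := by
    have h : (2 * s) • cayley Z = (2 * s) • ((N.det / s) • G) := by
      rw [cayley, ← Matrix.mul_smul, hadj, Matrix.mul_smul, hPK, smul_smul, smul_smul]
      congr 1
      field_simp
    exact smul_right_injective _ (mul_ne_zero two_ne_zero hs0) h
  refine commute_pureMat_const_of_smul (div_ne_zero hNdet hs0) ?_
  rw [← hW]
  exact commute_cayley hA Z

/-! ### Equivariance in terms of Choi matrices. -/

/-- The Choi correspondence as a linear equivalence. -/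
def ofChoiEquiv (n k : ℕ) : TMat n (k + 1) ≃ₗ[ℂ] (Mat n →ₗ[ℂ] TMat n k) where
  toFun := ofChoi
  invFun := choi
  left_inv := choi_ofChoi
  right_inv := ofChoi_choi
  map_add' C D := by
    refine LinearMap.ext fun X => ?_
    ext x y
    simp [ofChoi, mul_add, Finset.sum_add_distrib]
  map_smul' c C := by
    refine LinearMap.ext fun X => ?_
    ext x y
    simp [ofChoi, Finset.mul_sum, mul_left_comm]

/-- Partial transposition as a linear equivalence. -/
def partialTransposeEquiv (n m r : ℕ) : TMat n m ≃ₗ[ℂ] TMat n m :=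
  LinearEquiv.ofInvolutive (partialTranspose r) (partialTranspose_partialTranspose r)

/-- The linear map whose partially transposed Choi matrix is a given matrix. -/
def ofWiredChoi (n a b : ℕ) : TMat n (a + b + 1) ≃ₗ[ℂ] (Mat n →ₗ[ℂ] TMat n (a + b)) :=
  (partialTransposeEquiv n (a + b + 1) (a + 1)).trans (ofChoiEquiv n (a + b))

theorem ofWiredChoi_permOp (a b : ℕ) (π : Equiv.Perm (Fin (a + b + 1))) :
    ofWiredChoi n a b (permOp n π) = basisMap n a b π := rfl

theorem basisMap_eq_comp (n a b : ℕ) :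
    basisMap n a b = (ofWiredChoi n a b).toLinearMap ∘ permOp n := rfl

theorem ofChoi_pureMat {k : ℕ} (A : Fin (k + 1) → Mat n) (X : Mat n) :
    ofChoi (pureMat A) X = (X * (A 0)ᵀ).trace • pureMat (Fin.tail A) := by
  ext x y
  simp [ofChoi, pureMat, Fin.prod_univ_succ, Matrix.trace, Matrix.mul_apply, Finset.sum_mul,
    mul_assoc, Fin.tail]

/-- On elementary tensors factor `0` enters only through a trace with `X`, and cyclicity moves its
multipliers onto `X`. -/
theorem ofChoi_mul_mul {k : ℕ} (A B : Fin (k + 1) → Mat n) (C : TMat n (k + 1)) (X : Mat n) :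
    ofChoi (pureMat A * C * pureMat B) X =
      pureMat (Fin.tail A) * ofChoi C ((A 0)ᵀ * X * (B 0)ᵀ) * pureMat (Fin.tail B) := by
  have := linearMap_ext_pureMat
    (f := LinearMap.applyₗ X ∘ₗ (ofChoiEquiv n k).toLinearMap ∘ₗ
      LinearMap.mulRight ℂ (pureMat B) ∘ₗ LinearMap.mulLeft ℂ (pureMat A))
    (g := LinearMap.mulRight ℂ (pureMat (Fin.tail B)) ∘ₗ
      LinearMap.mulLeft ℂ (pureMat (Fin.tail A)) ∘ₗ LinearMap.applyₗ ((A 0)ᵀ * X * (B 0)ᵀ) ∘ₗ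
        (ofChoiEquiv n k).toLinearMap)
    (fun D => by
      change ofChoi (pureMat A * pureMat D * pureMat B) X =
        pureMat (Fin.tail A) * ofChoi (pureMat D) ((A 0)ᵀ * X * (B 0)ᵀ) * pureMat (Fin.tail B)
      rw [pureMat_mul, pureMat_mul, ofChoi_pureMat, ofChoi_pureMat, Matrix.mul_smul,
        Matrix.smul_mul, pureMat_mul, pureMat_mul]
      congr 1
      rw [Matrix.transpose_mul, Matrix.transpose_mul, Matrix.trace_mul_comm,
        Matrix.mul_assoc (A 0)ᵀ, Matrix.mul_assoc (A 0)ᵀ, Matrix.trace_mul_comm (A 0)ᵀ,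
        Matrix.trace_mul_comm]
      simp only [Matrix.mul_assoc])
  exact LinearMap.congr_fun this C

theorem mixedPower_eq (a b : ℕ) (U : Mat n) :
    mixedPower a b U = pureMat fun i => if i.val < a then U.map star else U := by
  rw [mixedPower]
  congr 1
  funext i
  refine Fin.addCases (fun i => ?_) (fun i => ?_) i <;> simp

/-- Partial transposition turns the first `a + 1` copies of `U` into `Ū`. One of them is absorbed
into the argument `X`, which leaves `a` copies of `Ū` and `b` of `U`. -/
theorem ofWiredChoi_conj (a b : ℕ) (U : Mat n) (C : TMat n (a + b + 1)) (X : Mat n) :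
    ofWiredChoi n a b (pureMat (fun _ => U) * C * (pureMat fun _ => U)ᴴ) X =
      mixedPower a b U * ofWiredChoi n a b C (Uᴴ * X * U) * (mixedPower a b U)ᴴ := by
  change ofChoi (partialTranspose (a + 1) _) X =
    _ * ofChoi (partialTranspose (a + 1) C) (Uᴴ * X * U) * _
  rw [pureMat_conjTranspose, partialTranspose_mul_mul, ofChoi_mul_mul, mixedPower_eq,
    pureMat_conjTranspose]
  congr 2
  · congr 2
    funext i
    simp only [Fin.tail, Fin.val_succ, add_lt_add_iff_right]
    split_ifs <;> rfl
  · funext i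
    simp only [Fin.tail, Fin.val_succ, add_lt_add_iff_right]
    split_ifs
    · ext j k
      simp
    · rfl

theorem ofWiredChoi_mem_equivariantMaps_iff (a b : ℕ) (C : TMat n (a + b + 1)) :
    ofWiredChoi n a b C ∈ equivariantMaps n a b ↔ ∀ U ∈ Matrix.unitaryGroup (Fin n) ℂ,
      C * pureMat (fun _ => U) = pureMat (fun _ => U) * C := by
  refine forall₂_congr fun U hU => ?_
  have h1 : Uᴴ * U = 1 := Matrix.mem_unitaryGroup_iff'.1 hU
  have h2 : U * Uᴴ = 1 := Matrix.mem_unitaryGroup_iff.1 hU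
  have hV : (pureMat fun _ : Fin (a + b + 1) => U)ᴴ * pureMat (fun _ => U) = 1 := by
    rw [pureMat_conjTranspose, pureMat_mul, h1, pureMat_one]
  have hV' : pureMat (fun _ : Fin (a + b + 1) => U) * (pureMat fun _ => U)ᴴ = 1 := by
    rw [pureMat_conjTranspose, pureMat_mul, h2, pureMat_one]
  constructor
  · intro h
    have hC : pureMat (fun _ => U) * C * (pureMat fun _ => U)ᴴ = C := by
      refine (ofWiredChoi n a b).injective (LinearMap.ext fun X => ?_)
      rw [ofWiredChoi_conj, ← h]
      congr 1
      rw [← Matrix.mul_assoc, ← Matrix.mul_assoc, h2, Matrix.one_mul, Matrix.mul_assoc, h2,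
        Matrix.mul_one]
    conv_lhs => rw [← hC]
    rw [Matrix.mul_assoc, hV, Matrix.mul_one]
  · intro h X
    have hC : C = pureMat (fun _ => U) * C * (pureMat fun _ => U)ᴴ := by
      rw [← h, Matrix.mul_assoc, hV', Matrix.mul_one]
    conv_lhs => rw [hC]
    rw [ofWiredChoi_conj]
    congr 3
    rw [← Matrix.mul_assoc, ← Matrix.mul_assoc, h1, Matrix.one_mul, Matrix.mul_assoc, h1,
      Matrix.mul_one]

theorem span_range_basisMap (n a b : ℕ) :
    Submodule.span ℂ (Set.range (basisMap n a b)) = equivariantMaps n a b := by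
  refine le_antisymm (Submodule.span_le.2 ?_) fun Φ hΦ => ?_
  · rintro _ ⟨π, rfl⟩
    rw [← ofWiredChoi_permOp, SetLike.mem_coe, ofWiredChoi_mem_equivariantMaps_iff]
    exact fun U _ => permOp_mul_pureMat_const π U
  · obtain ⟨C, rfl⟩ := (ofWiredChoi n a b).surjective Φ
    rw [ofWiredChoi_mem_equivariantMaps_iff] at hΦ
    rw [basisMap_eq_comp, Set.range_comp, Submodule.span_image]
    exact Submodule.mem_map_of_mem
      (mem_span_permOp_of_commute (commute_pureMat_const_of_unitary hΦ))

/-! ### Linear independence of the permutation operators. -/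

theorem linearIndependent_permOp {m : ℕ} (h : m ≤ n) :
    LinearIndependent ℂ (permOp n (m := m)) := by
  rw [Fintype.linearIndependent_iff]
  intro g hg π
  -- The row index has distinct entries, so only `π` contributes to this matrix entry.
  have := congrFun (congrFun hg (Fin.castLE h)) (Fin.castLE h ∘ π)
  simp only [Matrix.sum_apply, Matrix.smul_apply, permOp_apply,
    (Fin.castLE_injective h).comp_left.eq_iff, DFunLike.coe_fn_eq, smul_eq_mul, mul_ite, mul_one,
    mul_zero, Finset.sum_ite_eq', Finset.mem_univ, if_true, Matrix.zero_apply] at this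
  exact this

/-- The antisymmetrizer vanishes if there are more tensor factors than dimensions. -/
theorem sum_sign_smul_permOp_eq_zero {m : ℕ} (h : n < m) :
    ∑ π : Equiv.Perm (Fin m), ((Equiv.Perm.sign π : ℤ) : ℂ) • permOp n π = 0 := by
  ext x y
  -- Each entry of the antisymmetrizer is a determinant of Kronecker deltas, here with rows `i` and
  -- `j` equal.
  obtain ⟨i, j, hij, hx⟩ := Fintype.exists_ne_map_eq_of_card_lt x (by simpa using h)
  have := Matrix.det_zero_of_row_eq (M := Matrix.of fun i j => if x i = y j then (1 : ℂ) else 0)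
    hij (by funext k; simp [hx])
  rw [Matrix.det_apply'] at this
  simp only [Matrix.sum_apply, Matrix.smul_apply, permOp_apply, Matrix.zero_apply, smul_eq_mul]
  refine (Finset.sum_congr rfl fun π _ => ?_).trans this
  simp [Finset.prod_ite_zero, funext_iff]

theorem linearIndependent_permOp_iff {m : ℕ} :
    LinearIndependent ℂ (permOp n (m := m)) ↔ m ≤ n := by
  refine ⟨fun h => ?_, linearIndependent_permOp⟩
  by_contra! hlt
  have := Fintype.linearIndependent_iff.1 h _ (sum_sign_smul_permOp_eq_zero hlt) 1
  simp at this

theorem linearIndependent_basisMap_iff (n a b : ℕ) :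
    LinearIndependent ℂ (basisMap n a b) ↔ a + b + 1 ≤ n := by
  rw [basisMap_eq_comp, LinearMap.linearIndependent_iff _ (ofWiredChoi n a b).ker,
    linearIndependent_permOp_iff]

/-! ### Wire diagrams. -/

theorem WireDiagram.toMatrix_injective {m : ℕ} (hn : 2 ≤ n) :
    Function.Injective (WireDiagram.toMatrix n : WireDiagram m → TMat n m) := by
  classical
  intro D E h
  refine WireDiagram.ext (funext fun p => ?_)
  -- Label `1` marks a single wire of `E`, so the entry for `E` is `1`. The equal entry for `D`
  -- forces the `D`-partner of `p` to carry label `1` too, and it is not `p` itself.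
  let l : Dot m → Fin n := fun q => if q = p ∨ q = E.partner p then ⟨1, hn⟩ else ⟨0, by omega⟩
  have hl : ∀ q, Dot.label (fun i => l (.input i)) (fun i => l (.output i)) q = l q := by
    rintro (i | i) <;> rfl
  have hE : ∀ q, l q = l (E.partner q) := by
    intro q
    have h1 : E.partner q = p ↔ q = E.partner p :=
      ⟨fun e => by rw [← e, E.partner_partner], fun e => by rw [e, E.partner_partner]⟩
    have h2 : E.partner q = E.partner p ↔ q = p :=
      (Function.LeftInverse.injective E.partner_partner).eq_iff
    simp only [l, h1, h2, or_comm]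
  have h1 := congrFun (congrFun h fun i => l (.input i)) fun i => l (.output i)
  simp only [WireDiagram.toMatrix, Matrix.of_apply, hl] at h1
  rw [if_pos hE] at h1
  have hD : ∀ q, l q = l (D.partner q) := by
    by_contra hne
    rw [if_neg hne] at h1
    exact zero_ne_one h1
  have hp := hD p
  by_contra hne
  simp [l, D.partner_ne, hne] at hp

/-- Black dots are indexed by their rows. -/
def blackEquiv (a b : ℕ) : BlackDot a b ≃ Fin (a + b + 1) where
  toFun p := p.val.row
  invFun i := if h : i.val < a + 1 then ⟨.input i, h⟩ else ⟨.output i, not_lt.1 h⟩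
  left_inv := by
    rintro ⟨i | i, h⟩
    · exact dif_pos h
    · exact dif_neg (not_lt.2 h)
  right_inv i := by
    by_cases h : i.val < a + 1 <;> simp [h, Dot.row]

/-- White dots are indexed by their rows. -/
def whiteEquiv (a b : ℕ) : WhiteDot a b ≃ Fin (a + b + 1) where
  toFun p := p.val.row
  invFun i := if h : i.val < a + 1 then ⟨.output i, not_le.2 h⟩ else ⟨.input i, h⟩
  left_inv := by
    rintro ⟨i | i, h⟩
    · exact dif_neg h
    · exact dif_pos (not_le.1 h)
  right_inv i := by
    by_cases h : i.val < a + 1 <;> simp [h, Dot.row]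

/-- The wiring of a permutation `π` joins the black dot of row `j` to the white dot of row `π j`. -/
def permWiring (a b : ℕ) : Equiv.Perm (Fin (a + b + 1)) ≃ Wiring a b :=
  Equiv.equivCongr (blackEquiv a b).symm (whiteEquiv a b).symm

theorem permWiring_row {a b : ℕ} (π : Equiv.Perm (Fin (a + b + 1))) (p : BlackDot a b) :
    (permWiring a b π p).val.row = π p.val.row :=
  (whiteEquiv a b).apply_symm_apply (π (blackEquiv a b p))

theorem Wiring.toDiagram_partner_of_isBlack {a b : ℕ} (w : Wiring a b) (p : BlackDot a b) :
    w.toDiagram.partner p = w p :=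
  dif_pos p.2

theorem Wiring.toDiagram_partner_of_not_isBlack {a b : ℕ} (w : Wiring a b) (p : WhiteDot a b) :
    w.toDiagram.partner p = w.symm p :=
  dif_neg p.2

theorem Wiring.toDiagram_injective {a b : ℕ} :
    Function.Injective (Wiring.toDiagram : Wiring a b → WireDiagram (a + b + 1)) := by
  intro w w' h
  refine Equiv.ext fun p => Subtype.ext ?_
  rw [← w.toDiagram_partner_of_isBlack, h, w'.toDiagram_partner_of_isBlack]

theorem Wiring.toMatrix_toDiagram_apply {a b : ℕ} (w : Wiring a b) (x y : Fin (a + b + 1) → Fin n) :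
    w.toDiagram.toMatrix n x y =
      open Classical in
      if ∀ p : BlackDot a b, Dot.label x y p = Dot.label x y (w p) then 1 else 0 := by
  classical
  have h : (∀ p, Dot.label x y p = Dot.label x y (w.toDiagram.partner p)) ↔
      ∀ p : BlackDot a b, Dot.label x y p = Dot.label x y (w p) := by
    constructor
    · intro h p
      rw [← w.toDiagram_partner_of_isBlack]
      exact h p
    · intro h p
      by_cases hp : p.IsBlack a b
      · rw [w.toDiagram_partner_of_isBlack ⟨p, hp⟩]
        exact h ⟨p, hp⟩
      · rw [w.toDiagram_partner_of_not_isBlack ⟨p, hp⟩, h, w.apply_symm_apply]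
  simp only [WireDiagram.toMatrix, Matrix.of_apply, h]

theorem label_blackEquiv_symm (a b : ℕ) (x y : Fin (a + b + 1) → Fin n) (i : Fin (a + b + 1)) :
    Dot.label x y ((blackEquiv a b).symm i).val = if i.val < a + 1 then x i else y i := by
  change Dot.label x y (Subtype.val (dite _ _ _)) = _
  split_ifs <;> rfl

theorem label_whiteEquiv_symm (a b : ℕ) (x y : Fin (a + b + 1) → Fin n) (i : Fin (a + b + 1)) :
    Dot.label x y ((whiteEquiv a b).symm i).val = if i.val < a + 1 then y i else x i := by
  change Dot.label x y (Subtype.val (dite _ _ _)) = _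
  split_ifs <;> rfl

theorem choi_basisMap_eq_toMatrix (n a b : ℕ) (π : Equiv.Perm (Fin (a + b + 1))) :
    choi (basisMap n a b π) = (permWiring a b π).toDiagram.toMatrix n := by
  classical
  ext x y
  rw [Wiring.toMatrix_toDiagram_apply, choi_basisMap]
  -- The two index functions are the labels of the white and of the black dots, row by row; the
  -- entry thus compares white row `π j` with black row `j`.
  change permOp n π (fun i => if i.val < a + 1 then y i else x i)
    (fun i => if i.val < a + 1 then x i else y i) = _
  rw [permOp_apply]
  refine if_congr ?_ rfl rfl
  rw [(blackEquiv a b).symm.forall_congr_right.symm, funext_iff]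
  refine forall_congr' fun j => ?_
  have h : permWiring a b π ((blackEquiv a b).symm j) = (whiteEquiv a b).symm (π j) := by
    simp [permWiring]
  rw [h, label_blackEquiv_symm, label_whiteEquiv_symm]
  exact eq_comm

theorem basisMap_injective (a b : ℕ) (hn : 2 ≤ n) : Function.Injective (basisMap n a b) := by
  intro π ρ h
  have := congrArg choi h
  rw [choi_basisMap_eq_toMatrix, choi_basisMap_eq_toMatrix] at this
  exact (permWiring a b).injective
    (Wiring.toDiagram_injective (WireDiagram.toMatrix_injective hn this))

end WireCalculus

theorem mainTheorem9 (n a b : ℕ) (hn : 2 ≤ n) :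
    Submodule.span ℂ (Set.range (basisMap n a b)) = equivariantMaps n a b ∧
    (LinearIndependent ℂ (basisMap n a b) ↔ a + b + 1 ≤ n) ∧
    Function.Injective (basisMap n a b) ∧
    ∃ w : Equiv.Perm (Fin (a + b + 1)) ≃ Wiring a b,
      (∀ (π : Equiv.Perm (Fin (a + b + 1))) (p : BlackDot a b),
        (w π p).val.row = π p.val.row) ∧
      (∀ π : Equiv.Perm (Fin (a + b + 1)),
        choi (basisMap n a b π) = (Wiring.toDiagram (w π)).toMatrix n) ∧
      (∀ (π : Equiv.Perm (Fin (a + b + 1))) (D : WireDiagram (a + b + 1)),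
        D.toMatrix n = choi (basisMap n a b π) → D = Wiring.toDiagram (w π)) := by
  refine ⟨span_range_basisMap n a b, linearIndependent_basisMap_iff n a b,
    basisMap_injective a b hn, permWiring a b, permWiring_row, choi_basisMap_eq_toMatrix n a b,
    fun π D hD => WireDiagram.toMatrix_injective hn ?_⟩
  rw [hD, choi_basisMap_eq_toMatrix]
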